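/- Let $A=V/\Lambda$ be a complex abelian variety of dimension $g$ ($V=T_0A$) and let $\Theta$ be a symmetric effective divisor on $A$ ($(-1)^*\Theta=\Theta$) that induces a principal polarization on $A$. Let $\mathrm{Km}\colon A\to\mathbb{P}H^0(A,2\Theta)^*$ be the Kummer map, sending a point to the evaluation functional at it, and let $\mathcal{G}\colon\Theta^{sm}\to\mathbb{P}(T_0A^*)\cong\mathbb{P}^{g-1}$ be the Gauss map on the smooth locus of $\Theta$, sending $x$ to the class of the differential at $x$ of a local equation of $\Theta$. Let $r\ge 1$, and let $x_1\in A$ and $x_2,\dots,x_r\in\Theta$ be points such that $\mathrm{Km}(x_1),\dots,\mathrm{Km}(x_r)$ are contained in an $(r-2)$-dimensional linear subspace of $\mathbb{P}H^0(A,2\Theta)^*$, while for every $j$ the $r-1$ points $\mathrm{Km}(x_i)$, $i\ne j$, are linearly independent. Then: 1. $x_1\in\Theta$; 2. the points $\mathcal{G}(x_i)$, for those $i$ with $x_i\in\Theta^{sm}$, span a linear subspace of $\mathbb{P}(T_0A^*)$ of dimension at most $\lfloor r/2\rfloor-1$; 3. if, for some $j$, all the points $x_i$ with $i\ne j$ are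 singular points of $\Theta$, then $x_j$ is a singular point of $\Theta$ as well. -/

import Mathlib

open scoped ComplexConjugate LinearAlgebra.Projectivization

/-! Complex abelian varieties are written as complex tori `V ⧸ Λ`, with `V` the tangent space at
the origin and `Λ` a lattice in `V`, polarised by a Hermitian form. -/

section

variable {V : Type*} [NormedAddCommGroup V] [NormedSpace ℂ V]

/-- A holomorphic function on `V` without zeros. -/
def IsHolUnit (u : V → ℂ) : Prop :=
  Differentiable ℂ u ∧ ∀ v, u v ≠ 0

/-- A principal polarization of the complex torus `V ⧸ Λ`: a positive definite Hermitian form `H`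
on `V` (linear in the first variable) whose imaginary part takes integral values on `Λ` and
is unimodular there, i.e. induces a surjection (hence an isomorphism) from `Λ` to its dual. -/
structure IsPrincipalPolarization (Λ : Submodule ℤ V) (H : V →ₗ[ℂ] V →ₗ⋆[ℂ] ℂ) : Prop where
  hermitian : ∀ v w, H w v = conj (H v w)
  pos : ∀ v, v ≠ 0 → 0 < (H v v).re
  integral : ∀ l ∈ Λ, ∀ m ∈ Λ, ∃ n : ℤ, (H l m).im = n
  unimodular : ∀ φ : Λ →ₗ[ℤ] ℤ, ∃ l : Λ, ∀ m : Λ, (H l m).im = φ m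

/-- A semicharacter of `Λ` for `H`: `α (l + m) = α l * α m * (-1) ^ (Im H l m)`, `‖α l‖ = 1`. -/
def IsSemicharacter (Λ : Submodule ℤ V) (H : V →ₗ[ℂ] V →ₗ⋆[ℂ] ℂ) (α : Λ → ℂ) : Prop :=
  (∀ l, ‖α l‖ = 1) ∧
  ∀ l m : Λ, α (l + m) = α l * α m * Complex.exp (Real.pi * Complex.I * ((H l m).im : ℂ))

/-- Holomorphic sections on `V ⧸ Λ` of the line bundle `L(H, α)`, whose first Chern class is `H`:
holomorphic functions on `V` with the factor of automorphy
`α l * exp (π H(v, l) + π / 2 H(l, l))`. -/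
def IsCanonicalTheta (Λ : Submodule ℤ V) (H : V →ₗ[ℂ] V →ₗ⋆[ℂ] ℂ) (α : Λ → ℂ)
    (f : V → ℂ) : Prop :=
  Differentiable ℂ f ∧
  ∀ (l : Λ) (v : V), f (v + l) =
    α l * Complex.exp (Real.pi * H v l + Real.pi / 2 * H l l) * f v

/-- An effective divisor on the complex torus `V ⧸ Λ`, given by a global equation `eqn` on the
universal cover `V` of its (`Λ`-invariant) preimage. -/
structure TorusDivisor (Λ : Submodule ℤ V) where
  /-- the equation -/
  eqn : V → ℂ
  holo : Differentiable ℂ eqn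
  nonzero : ∃ v, eqn v ≠ 0
  periodic : ∀ l ∈ Λ, ∃ e : V → ℂ, IsHolUnit e ∧ ∀ v, eqn (v + l) = e v * eqn v

namespace TorusDivisor

variable {Λ : Submodule ℤ V} (Θ : TorusDivisor Λ)

/-- `(-1)^* Θ = Θ` as divisors. -/
def IsSymmetric : Prop :=
  ∃ u : V → ℂ, IsHolUnit u ∧ ∀ v, Θ.eqn (-v) = u v * Θ.eqn v

/-- The line bundle of `Θ` is isomorphic to some `L(H, α)` with `H` a principal polarization:
up to a unit, the equation of `Θ` is a section of `L(H, α)`. -/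
def InducesPrincipalPolarization : Prop :=
  ∃ H : V →ₗ[ℂ] V →ₗ⋆[ℂ] ℂ, IsPrincipalPolarization Λ H ∧
    ∃ α : Λ → ℂ, IsSemicharacter Λ H α ∧
      ∃ u : V → ℂ, IsHolUnit u ∧ IsCanonicalTheta Λ H α (fun v => u v * Θ.eqn v)

/-- The points of `Θ` on `V ⧸ Λ`. -/
def support : Set (V ⧸ Λ) :=
  {x | ∃ v : V, Submodule.Quotient.mk v = x ∧ Θ.eqn v = 0}

/-- The singular points of `Θ`: the equation and its differential vanish. -/
def singularLocus : Set (V ⧸ Λ) :=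
  {x | ∃ v : V, Submodule.Quotient.mk v = x ∧ Θ.eqn v = 0 ∧ fderiv ℂ Θ.eqn v = 0}

/-- The smooth points of `Θ`. -/
def smoothLocus : Set (V ⧸ Λ) := Θ.support \ Θ.singularLocus

/-- The space `H⁰(V ⧸ Λ, nΘ)`. A function `f` stands for the meromorphic function `f / eqn ^ n`
on `V ⧸ Λ`, with poles bounded by `nΘ`; the condition says that this quotient is
`Λ`-periodic. -/
def sections (n : ℕ) : Submodule ℂ (V → ℂ) where
  carrier := {f | Differentiable ℂ f ∧
    ∀ l ∈ Λ, ∀ v, f (v + l) * Θ.eqn v ^ n = f v * Θ.eqn (v + l) ^ n}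
  zero_mem' := ⟨differentiable_const 0, by simp⟩
  add_mem' := by
    rintro f g ⟨hf, hf'⟩ ⟨hg, hg'⟩
    refine ⟨hf.add hg, fun l hl v => ?_⟩
    simp only [Pi.add_apply, add_mul, hf' l hl v, hg' l hl v]
  smul_mem' := by
    rintro c f ⟨hf, hf'⟩
    refine ⟨hf.const_smul c, fun l hl v => ?_⟩
    simp only [Pi.smul_apply, smul_eq_mul, mul_assoc, hf' l hl v]

/-- Evaluation of sections of `nΘ` at (a lift to `V` of) a point, in the trivialisation on `V`. -/
def evalAt (n : ℕ) (v : V) : Module.Dual ℂ (Θ.sections n) :=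
  (LinearMap.proj v).comp (Θ.sections n).subtype

theorem eq_zero_of_isOpen {f : V → ℂ} (hf : Differentiable ℂ f) {U : Set V} (hU : IsOpen U)
    (hne : U.Nonempty) (h0 : ∀ v ∈ U, f v = 0) (v : V) : f v = 0 := by
  obtain ⟨w, hw⟩ := hne
  let c : ℂ → V := fun t => w + t • (v - w)
  have hc : Differentiable ℂ c := by fun_prop
  have hg : AnalyticOnNhd ℂ (f ∘ c) Set.univ := fun t _ => (hf.comp hc).analyticAt t
  have hev : (f ∘ c) =ᶠ[nhds 0] 0 := by
    have : c ⁻¹' U ∈ nhds (0 : ℂ) :=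
      (hU.preimage hc.continuous).mem_nhds (by simpa [c] using hw)
    filter_upwards [this] with t ht using h0 _ ht
  have := hg.eqOn_zero_of_preconnected_of_eventuallyEq_zero isPreconnected_univ
    (Set.mem_univ 0) hev (Set.mem_univ 1)
  simpa [c] using this

theorem dense_ne_zero : Dense {v | Θ.eqn v ≠ 0} := by
  intro v
  by_contra hv
  obtain ⟨w, hw⟩ := Θ.nonzero
  refine hw (eq_zero_of_isOpen Θ.holo (U := (closure {v | Θ.eqn v ≠ 0})ᶜ)
    isClosed_closure.isOpen_compl ⟨v, hv⟩ (fun z hz => ?_) w)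
  by_contra h
  exact hz (subset_closure h)

theorem section_add {n : ℕ} {f : V → ℂ} (hf : f ∈ Θ.sections n) {l : V} (hl : l ∈ Λ)
    {e : V → ℂ} (he : IsHolUnit e) (h : ∀ v, Θ.eqn (v + l) = e v * Θ.eqn v) (v : V) :
    f (v + l) = e v ^ n * f v := by
  have h1 : Continuous fun v => f (v + l) := hf.1.continuous.comp (by fun_prop)
  have h2 : Continuous fun v => e v ^ n * f v := (he.1.continuous.pow n).mul hf.1.continuous
  refine congrFun (h1.ext_on Θ.dense_ne_zero h2 fun w hw => ?_) v
  have := hf.2 l hl w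
  rw [h w, mul_pow] at this
  have hw' : Θ.eqn w ^ n ≠ 0 := pow_ne_zero n hw
  apply mul_right_cancel₀ hw'
  simp only
  rw [this]; ring

theorem evalAt_ne_zero (h : Θ.InducesPrincipalPolarization) (v : V) : Θ.evalAt 2 v ≠ 0 := by
  obtain ⟨H, -, α, -, u, hu, ht, hq⟩ := h
  set t : V → ℂ := fun v => u v * Θ.eqn v with ht_def
  have hopen : IsOpen {a : V | t (v + a) ≠ 0} :=
    isOpen_ne_fun (ht.continuous.comp (by fun_prop)) continuous_const
  have hne : {a : V | t (v + a) ≠ 0}.Nonempty := by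
    obtain ⟨w, hw⟩ := Θ.nonzero
    exact ⟨w - v, by simp [ht_def, hu.2, hw]⟩
  obtain ⟨a, ha, ha'⟩ : ∃ a, t (v + a) ≠ 0 ∧ t (v - a) ≠ 0 := by
    by_contra hcon
    push Not at hcon
    obtain ⟨w, hw⟩ := Θ.nonzero
    have hd : Differentiable ℂ fun a => t (v - a) := ht.comp (by fun_prop)
    have := eq_zero_of_isOpen hd hopen hne (fun a ha => hcon a ha) (v - w)
    simp [ht_def, hu.2, hw] at this
  let f : V → ℂ := fun z => t (z + a) * t (z - a) * (u z ^ 2)⁻¹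
  have hf : f ∈ Θ.sections 2 := by
    refine ⟨?_, fun l hl z => ?_⟩
    · have d1 : Differentiable ℂ fun z => t (z + a) := ht.comp (by fun_prop)
      have d2 : Differentiable ℂ fun z => t (z - a) := ht.comp (by fun_prop)
      have d3 : Differentiable ℂ fun z => (u z ^ 2)⁻¹ := fun z =>
        (differentiableAt_inv (pow_ne_zero 2 (hu.2 z))).comp z ((hu.1 z).pow 2)
      exact (d1.mul d2).mul d3
    · have e1 := hq ⟨l, hl⟩ (z + a)
      have e2 := hq ⟨l, hl⟩ (z - a)
      have e3 := hq ⟨l, hl⟩ z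
      have a1 : z + a + l = z + l + a := by abel
      have a2 : z - a + l = z + l - a := by abel
      simp only [a1, a2, map_add, map_sub, LinearMap.add_apply, LinearMap.sub_apply] at e1 e2 e3
      have key : t (z + l + a) * t (z + l - a) * t z ^ 2
          = t (z + a) * t (z - a) * t (z + l) ^ 2 := by
        rw [e1, e2, e3]
        have hx : Complex.exp (Real.pi * (H z l + H a l) + Real.pi / 2 * H l l)
            * Complex.exp (Real.pi * (H z l - H a l) + Real.pi / 2 * H l l)
            = Complex.exp (Real.pi * H z l + Real.pi / 2 * H l l) ^ 2 := by
          rw [← Complex.exp_add, sq, ← Complex.exp_add]; congr 1; ring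
        linear_combination (α ⟨l, hl⟩ ^ 2 * t (z + a) * t (z - a) * t z ^ 2) * hx
      have k2 : t z = u z * Θ.eqn z := rfl
      have k3 : t (z + l) = u (z + l) * Θ.eqn (z + l) := rfl
      rw [k2, k3] at key
      have n1 := hu.2 z
      have n2 := hu.2 (z + l)
      simp only [f]
      field_simp
      linear_combination key
  intro h0
  have := LinearMap.congr_fun h0 ⟨f, hf⟩
  have hfv : f v ≠ 0 := mul_ne_zero (mul_ne_zero ha ha') (inv_ne_zero (pow_ne_zero 2 (hu.2 v)))
  exact hfv this

/-- The Kummer map `V ⧸ Λ → ℙ(H⁰(2Θ)^*)`, sending a point to the evaluation functional at it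
(which vanishes nowhere, and changes by a scalar with the lift of the point). -/
noncomputable def kummer (h : Θ.InducesPrincipalPolarization) (x : V ⧸ Λ) :
    ℙ ℂ (Module.Dual ℂ (Θ.sections 2)) :=
  Projectivization.mk ℂ (Θ.evalAt 2 (Quotient.out x)) (Θ.evalAt_ne_zero h _)

theorem out_mk {W : Type*} [AddCommGroup W] (M : Submodule ℤ W) (v : W) :
    ∃ l ∈ M, (Quotient.out (Submodule.Quotient.mk v : W ⧸ M) : W) = v + l := by
  refine ⟨Quotient.out (Submodule.Quotient.mk v : W ⧸ M) - v, ?_, by abel⟩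
  rw [← Submodule.Quotient.eq]
  exact Quotient.out_eq _

/-- The Kummer map can be computed with any lift. -/
theorem kummer_mk (h : Θ.InducesPrincipalPolarization) (v : V) :
    Θ.kummer h (Submodule.Quotient.mk v) =
      Projectivization.mk ℂ (Θ.evalAt 2 v) (Θ.evalAt_ne_zero h v) := by
  obtain ⟨l, hl, hv⟩ := out_mk Λ v
  obtain ⟨e, he, hev⟩ := Θ.periodic l hl
  rw [kummer, Projectivization.mk_eq_mk_iff']
  refine ⟨e v ^ 2, LinearMap.ext fun f => ?_⟩
  rw [hv]
  exact (Θ.section_add f.2 hl he hev v).symm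

theorem fderiv_add {l : V} {e : V → ℂ} (he : IsHolUnit e)
    (h : ∀ v, Θ.eqn (v + l) = e v * Θ.eqn v) {v : V} (hv : Θ.eqn v = 0) :
    fderiv ℂ Θ.eqn (v + l) = e v • fderiv ℂ Θ.eqn v := by
  rw [← fderiv_comp_add_right, funext h]
  rw [fderiv_fun_mul (he.1 v) (Θ.holo v), hv]
  ext z
  simp

theorem mem_smoothLocus_mk (v : V) : (Submodule.Quotient.mk v : V ⧸ Λ) ∈ Θ.smoothLocus ↔
    Θ.eqn v = 0 ∧ fderiv ℂ Θ.eqn v ≠ 0 := by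
  constructor
  · rintro ⟨⟨w, hw, hw0⟩, hs⟩
    have hl := (Submodule.Quotient.eq Λ).1 hw.symm
    obtain ⟨e, he, hev⟩ := Θ.periodic _ hl
    have hv : Θ.eqn v = 0 := by
      have := hev w
      rw [hw0, mul_zero, add_sub_cancel] at this
      exact this
    exact ⟨hv, fun h => hs ⟨v, rfl, hv, h⟩⟩
  · rintro ⟨h0, h1⟩
    refine ⟨⟨v, rfl, h0⟩, ?_⟩
    rintro ⟨w, hw, hw0, hw1⟩
    have hl := (Submodule.Quotient.eq Λ).1 hw.symm
    obtain ⟨e, he, hev⟩ := Θ.periodic _ hl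
    have := Θ.fderiv_add he hev hw0
    rw [hw1, add_sub_cancel] at this
    refine h1 (this.trans ?_)
    ext z
    simp

/-- The Gauss map `Θ^sm → ℙ(T_0^*)`: the class of the differential of the equation. -/
noncomputable def gauss (x : Θ.smoothLocus) : ℙ ℂ (V →L[ℂ] ℂ) :=
  Projectivization.mk ℂ (fderiv ℂ Θ.eqn (Quotient.out x.1))
    ((Θ.mem_smoothLocus_mk _).1
      (by rw [show (Submodule.Quotient.mk (Quotient.out x.1) : V ⧸ Λ) = x.1 from
        Quotient.out_eq _]; exact x.2)).2

/-- The Gauss map can be computed with any lift. -/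
theorem gauss_mk (v : V) (hv : (Submodule.Quotient.mk v : V ⧸ Λ) ∈ Θ.smoothLocus) :
    Θ.gauss ⟨Submodule.Quotient.mk v, hv⟩ =
      Projectivization.mk ℂ (fderiv ℂ Θ.eqn v) ((Θ.mem_smoothLocus_mk v).1 hv).2 := by
  obtain ⟨l, hl, hvl⟩ := out_mk Λ v
  obtain ⟨e, he, hev⟩ := Θ.periodic l hl
  rw [gauss, Projectivization.mk_eq_mk_iff']
  refine ⟨e v, ?_⟩
  simp only [hvl]
  exact (Θ.fderiv_add he hev ((Θ.mem_smoothLocus_mk v).1 hv).1).symm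

end TorusDivisor

end

/-!
Let `t = u * eqn` be the theta function of the polarization. For every `a : V` the function
`z ↦ t (z + a) * t (z - a) / u z ^ 2` is a section of `2Θ`. A minimal linear relation between
the points `Km (x i)` is therefore a relation `∑ c i * t (v i + a) * t (v i - a) = 0`, valid for
all `a`, where `v i` lifts `x i` and where no `c i` vanishes (`exists_theta_relation`). Its Taylor
expansion at `a = 0` gives all three claims.

* In degree zero it reads `∑ c i * t (v i) ^ 2 = 0`. All terms but the first vanish, hence so
  does the first, and `x 0 ∈ Θ`.
* In degree two it reads `∑ c i * (dt (v i)) ^ 2 = 0` as a quadratic form on `V`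
  (`exists_differential_relation`), because each `t (v i)` vanishes. So the image of
  `a ↦ (dt (v i) a)ᵢ` is isotropic for the nondegenerate form `∑ c i * y i ^ 2` on `ℂ ^ r`, and
  its dimension, which is that of the span of the `dt (v i)`, is at most `r / 2`
  (`two_mul_finrank_span_le_card`). If all `dt (v i)` but one vanish, so does the last.
-/

section

/-- If nonzero multiples of the squares of some linear forms add up to zero, then the forms span
a space of dimension at most half their number: an isotropic subspace for a nondegenerate
quadratic form has at most half the dimension of the ambient space. -/
theorem two_mul_finrank_span_le_card {V ι : Type*} [NormedAddCommGroup V] [NormedSpace ℂ V]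
    [Fintype ι] (c : ι → ℂ) (hc : ∀ i, c i ≠ 0) (d : ι → V →L[ℂ] ℂ)
    (h : ∀ a, ∑ i, c i * d i a ^ 2 = 0) :
    2 * Module.finrank ℂ (Submodule.span ℂ (Set.range d)) ≤ Fintype.card ι := by
  have hpolar : ∀ a b, ∑ i, c i * d i a * d i b = 0 := by
    intro a b
    have h2 : ∑ i, c i * d i (a + b) ^ 2 = (∑ i, c i * d i a ^ 2) + (∑ i, c i * d i b ^ 2)
        + 2 * ∑ i, c i * d i a * d i b := by
      rw [Finset.mul_sum, ← Finset.sum_add_distrib, ← Finset.sum_add_distrib]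
      refine Finset.sum_congr rfl fun i _ => ?_
      rw [map_add]; ring
    simpa only [h, zero_add, add_zero, zero_eq_mul, two_ne_zero, false_or] using h2
  let L : V →ₗ[ℂ] ι → ℂ := LinearMap.pi fun i => (d i : V →ₗ[ℂ] ℂ)
  let T : (ι → ℂ) →ₗ[ℂ] V →L[ℂ] ℂ := Fintype.linearCombination ℂ d
  let D : (ι → ℂ) →ₗ[ℂ] ι → ℂ := LinearMap.pi fun i => c i • LinearMap.proj i
  have hD : Function.Injective D := by
    intro y z hyz
    ext i
    have := congrFun hyz i
    simpa [D, hc i] using this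
  -- `L` and `T` are transposes of each other, so they have the same rank.
  have hrank : Module.finrank ℂ (Submodule.span ℂ (Set.range d)) ≤
      Module.finrank ℂ (LinearMap.range L) := by
    let C : (V →L[ℂ] ℂ) →ₗ[ℂ] Module.Dual ℂ V := ContinuousLinearMap.coeLM ℂ
    have hC : Function.Injective C := ContinuousLinearMap.coe_injective
    rw [← LinearMap.finrank_range_dualMap_eq_finrank_range L,
      (Submodule.equivMapOfInjective C hC _).finrank_eq]
    refine Submodule.finrank_mono ?_
    rw [Submodule.map_span_le]
    rintro _ ⟨i, rfl⟩
    exact ⟨LinearMap.proj i, rfl⟩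
  -- Polarized, the hypothesis says that `D` maps `range L` into the relations between the `d i`.
  have hker : Module.finrank ℂ (LinearMap.range L) ≤ Module.finrank ℂ (LinearMap.ker T) := by
    rw [(Submodule.equivMapOfInjective D hD _).finrank_eq]
    refine Submodule.finrank_mono ?_
    rintro _ ⟨_, ⟨a, rfl⟩, rfl⟩
    ext b
    simpa [T, D, L, Fintype.linearCombination_apply] using hpolar a b
  have hT := LinearMap.finrank_range_add_finrank_ker T
  rw [Fintype.range_linearCombination, Module.finrank_fintype_fun_eq_card] at hT
  omega

namespace TorusDivisor

variable {V : Type*} [NormedAddCommGroup V] [NormedSpace ℂ V] {Λ : Submodule ℤ V}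
  (Θ : TorusDivisor Λ)

/-- The sections of `2Θ` given by the theorem of the square: `Θ + a` and `Θ - a` add up to a
divisor linearly equivalent to `2Θ`. -/
theorem mul_translates_mem_sections {H : V →ₗ[ℂ] V →ₗ⋆[ℂ] ℂ} {α : Λ → ℂ} {u : V → ℂ}
    (hu : IsHolUnit u) (ht : IsCanonicalTheta Λ H α fun v => u v * Θ.eqn v) (a : V) :
    (fun z => u (z + a) * Θ.eqn (z + a) * (u (z - a) * Θ.eqn (z - a)) * (u z ^ 2)⁻¹) ∈
      Θ.sections 2 := by
  obtain ⟨ht, hq⟩ := ht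
  set t : V → ℂ := fun v => u v * Θ.eqn v with ht_def
  change (fun z => t (z + a) * t (z - a) * (u z ^ 2)⁻¹) ∈ _
  refine ⟨?_, fun l hl z => ?_⟩
  · have d1 : Differentiable ℂ fun z => t (z + a) := ht.comp (by fun_prop)
    have d2 : Differentiable ℂ fun z => t (z - a) := ht.comp (by fun_prop)
    have d3 : Differentiable ℂ fun z => (u z ^ 2)⁻¹ := (hu.1.pow 2).inv fun z =>
      pow_ne_zero 2 (hu.2 z)
    exact (d1.mul d2).mul d3
  · have e1 := hq ⟨l, hl⟩ (z + a)
    have e2 := hq ⟨l, hl⟩ (z - a)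
    have e3 := hq ⟨l, hl⟩ z
    rw [add_right_comm] at e1
    rw [sub_add_eq_add_sub] at e2
    simp only [map_add, map_sub, LinearMap.add_apply, LinearMap.sub_apply] at e1 e2 e3
    have key : t (z + l + a) * t (z + l - a) * t z ^ 2
        = t (z + a) * t (z - a) * t (z + l) ^ 2 := by
      rw [e1, e2, e3]
      have hx : Complex.exp (Real.pi * (H z l + H a l) + Real.pi / 2 * H l l)
          * Complex.exp (Real.pi * (H z l - H a l) + Real.pi / 2 * H l l)
          = Complex.exp (Real.pi * H z l + Real.pi / 2 * H l l) ^ 2 := by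
        rw [← Complex.exp_add, sq, ← Complex.exp_add]; congr 1; ring
      linear_combination (α ⟨l, hl⟩ ^ 2 * t (z + a) * t (z - a) * t z ^ 2) * hx
    have k2 : t z = u z * Θ.eqn z := rfl
    have k3 : t (z + l) = u (z + l) * Θ.eqn (z + l) := rfl
    rw [k2, k3] at key
    have n1 := hu.2 z
    have n2 := hu.2 (z + l)
    field_simp
    linear_combination key

/-- If `r` points `Km (x i)` lie in a linear subspace of projective dimension `r - 2`, and any
`r - 1` of them are independent, then they satisfy a linear relation without vanishing
coefficients: a relation with `c j = 0` would relate the points other than `x j`. -/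
theorem exists_evalAt_relation (hpol : Θ.InducesPrincipalPolarization) {r : ℕ}
    (x : Fin r → V ⧸ Λ)
    (hspan : ∃ W : Submodule ℂ (Module.Dual ℂ (Θ.sections 2)),
      FiniteDimensional ℂ W ∧ Module.finrank ℂ W + 1 = r ∧
        ∀ i, (Θ.kummer hpol (x i)).submodule ≤ W)
    (hgen : ∀ j, Projectivization.Independent
      (fun i : {i : Fin r // i ≠ j} => Θ.kummer hpol (x i))) :
    ∃ c : Fin r → ℂ, (∀ i, c i ≠ 0) ∧
      ∑ i, c i • Θ.evalAt 2 (Quotient.out (x i)) = 0 := by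
  obtain ⟨W, hW, hr, hle⟩ := hspan
  let p : Fin r → Module.Dual ℂ (Θ.sections 2) := fun i => (Θ.kummer hpol (x i)).rep
  have hpW : ∀ i, p i ∈ W := fun i => hle i <| by
    rw [Projectivization.submodule_eq]
    exact Submodule.mem_span_singleton_self _
  have hdep : ¬ LinearIndependent ℂ p := by
    intro hli
    have hli' : LinearIndependent ℂ fun i => (⟨p i, hpW i⟩ : W) :=
      LinearIndependent.of_comp W.subtype hli
    have := hli'.fintype_card_le_finrank
    rw [Fintype.card_fin] at this
    omega
  obtain ⟨c, hc, i₀, hi₀⟩ := Fintype.not_linearIndependent_iff.1 hdep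
  have hc0 : ∀ j, c j ≠ 0 := by
    intro j hj
    have hli := Projectivization.independent_iff.1 (hgen j)
    have hne : i₀ ≠ j := fun h => hi₀ (h ▸ hj)
    refine hi₀ (Fintype.linearIndependent_iff.1 hli (fun i => c i) ?_ ⟨i₀, hne⟩)
    rw [← hc, Fintype.sum_eq_add_sum_subtype_ne _ j, hj, zero_smul, zero_add]
    rfl
  choose b hb using fun i => Projectivization.exists_smul_eq_mk_rep ℂ _
    (Θ.evalAt_ne_zero hpol (Quotient.out (x i)))
  refine ⟨fun i => c i * (b i : ℂ), fun i => mul_ne_zero (hc0 i) (b i).ne_zero, ?_⟩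
  rw [← hc]
  refine Finset.sum_congr rfl fun i _ => ?_
  rw [mul_smul]
  exact congrArg (c i • ·) (hb i)

/-- A relation between values of sections of `2Θ`, written with the theta function `u * eqn`. -/
theorem exists_theta_relation {H : V →ₗ[ℂ] V →ₗ⋆[ℂ] ℂ} {α : Λ → ℂ} {u : V → ℂ}
    (hu : IsHolUnit u) (ht : IsCanonicalTheta Λ H α fun v => u v * Θ.eqn v)
    {ι : Type*} [Fintype ι] {v : ι → V} {c : ι → ℂ} (hc : ∀ i, c i ≠ 0)
    (h : ∑ i, c i • Θ.evalAt 2 (v i) = 0) :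
    ∃ c' : ι → ℂ, (∀ i, c' i ≠ 0) ∧ ∀ a, ∑ i, c' i *
      (u (v i + a) * Θ.eqn (v i + a) * (u (v i - a) * Θ.eqn (v i - a))) = 0 := by
  refine ⟨fun i => c i * (u (v i) ^ 2)⁻¹,
    fun i => mul_ne_zero (hc i) (inv_ne_zero (pow_ne_zero 2 (hu.2 _))), fun a => ?_⟩
  have := LinearMap.congr_fun h ⟨_, Θ.mul_translates_mem_sections hu ht a⟩
  simp only [LinearMap.sum_apply, LinearMap.smul_apply, smul_eq_mul, LinearMap.zero_apply] at this
  rw [← this]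
  refine Finset.sum_congr rfl fun i _ => ?_
  simp only [evalAt, LinearMap.comp_apply, Submodule.subtype_apply, LinearMap.proj_apply]
  ring

open Filter Topology in
/-- If `t` vanishes at `v`, then the expansion of `t (v + a) * t (v - a)` in `a` starts with the
quadratic term `-(dt a) ^ 2`. -/
theorem tendsto_mul_translates_div_sq {t : V → ℂ} (ht : Differentiable ℂ t) {v : V}
    (hv : t v = 0) (a : V) :
    Tendsto (fun s : ℂ => (s ^ 2)⁻¹ * (t (v + s • a) * t (v - s • a))) (𝓝[≠] 0)
      (𝓝 (-(fderiv ℂ t v a) ^ 2)) := by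
  have hslope : ∀ b : V, Tendsto (fun s : ℂ => s⁻¹ * t (v + s • b)) (𝓝[≠] 0)
      (𝓝 (fderiv ℂ t v b)) := fun b => by
    have := ((ht v).hasFDerivAt.hasLineDerivAt b).tendsto_slope_zero
    simpa [hv] using this
  have := (hslope a).mul (hslope (-a))
  rw [map_neg, mul_neg, ← sq] at this
  refine this.congr fun s => ?_
  rw [smul_neg, ← sub_eq_add_neg]
  ring

/-- The degree two part of a relation between the functions
`a ↦ u (v i + a) * eqn (v i + a) * u (v i - a) * eqn (v i - a)`, for points `v i` of `Θ`. -/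
theorem exists_differential_relation {u : V → ℂ} (hu : IsHolUnit u)
    {ι : Type*} [Fintype ι] {v : ι → V} (hv : ∀ i, Θ.eqn (v i) = 0) {c : ι → ℂ}
    (hc : ∀ i, c i ≠ 0) (h : ∀ a, ∑ i, c i *
      (u (v i + a) * Θ.eqn (v i + a) * (u (v i - a) * Θ.eqn (v i - a))) = 0) :
    ∃ c' : ι → ℂ, (∀ i, c' i ≠ 0) ∧ ∀ a, ∑ i, c' i * fderiv ℂ Θ.eqn (v i) a ^ 2 = 0 := by
  refine ⟨fun i => c i * u (v i) ^ 2, fun i => mul_ne_zero (hc i) (pow_ne_zero 2 (hu.2 _)),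
    fun a => ?_⟩
  have hlim := tendsto_finsetSum Finset.univ fun i _ =>
    (tendsto_mul_translates_div_sq (hu.1.mul Θ.holo) (v := v i) (by simp [hv]) a).const_mul (c i)
  have hzero : ∀ s : ℂ, ∑ i, c i * ((s ^ 2)⁻¹ * ((u * Θ.eqn) (v i + s • a) *
      (u * Θ.eqn) (v i - s • a))) = 0 := by
    intro s
    rw [← mul_zero (s ^ 2)⁻¹, ← h (s • a), Finset.mul_sum]
    refine Finset.sum_congr rfl fun i _ => ?_
    simp only [Pi.mul_apply]
    ring
  simp only [hzero] at hlim
  have hsum := tendsto_nhds_unique hlim tendsto_const_nhds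
  rw [← neg_eq_zero, ← hsum, ← Finset.sum_neg_distrib]
  refine Finset.sum_congr rfl fun i _ => ?_
  have hd : fderiv ℂ (u * Θ.eqn) (v i) a = u (v i) * fderiv ℂ Θ.eqn (v i) a := by
    rw [fderiv_mul (hu.1 _) (Θ.holo _), hv]
    simp
  rw [hd]
  ring

theorem mem_support_iff_out (x : V ⧸ Λ) : x ∈ Θ.support ↔ Θ.eqn (Quotient.out x) = 0 := by
  have hx : (Submodule.Quotient.mk (Quotient.out x) : V ⧸ Λ) = x := Quotient.out_eq _
  refine ⟨fun ⟨w, hw, hw0⟩ => ?_, fun h => ⟨_, hx, h⟩⟩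
  obtain ⟨e, -, hev⟩ := Θ.periodic _ ((Submodule.Quotient.eq Λ).1 (hx.trans hw.symm))
  have := hev w
  rwa [hw0, mul_zero, add_sub_cancel] at this

theorem mem_singularLocus_iff_out (x : V ⧸ Λ) : x ∈ Θ.singularLocus ↔
    Θ.eqn (Quotient.out x) = 0 ∧ fderiv ℂ Θ.eqn (Quotient.out x) = 0 := by
  have hx : (Submodule.Quotient.mk (Quotient.out x) : V ⧸ Λ) = x := Quotient.out_eq _
  refine ⟨fun hs => ?_, fun h => ⟨_, hx, h⟩⟩
  have h0 := (Θ.mem_support_iff_out x).1 (let ⟨w, hw, hw0, _⟩ := hs; ⟨w, hw, hw0⟩)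
  by_contra hcon
  have := (Θ.mem_smoothLocus_mk (Quotient.out x)).2 ⟨h0, fun h => hcon ⟨h0, h⟩⟩
  rw [hx] at this
  exact this.2 hs

end TorusDivisor

end

theorem propositionp1
    {V : Type*} [NormedAddCommGroup V] [NormedSpace ℂ V] [FiniteDimensional ℂ V]
    (Λ : Submodule ℤ V) [DiscreteTopology Λ] [IsZLattice ℝ Λ]
    (Θ : TorusDivisor Λ) (hsymm : Θ.IsSymmetric) (hpol : Θ.InducesPrincipalPolarization)
    (r : ℕ) [NeZero r] (x : Fin r → V ⧸ Λ)
    (hx : ∀ i, i ≠ 0 → x i ∈ Θ.support)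
    (hspan : ∃ W : Submodule ℂ (Module.Dual ℂ (Θ.sections 2)),
      FiniteDimensional ℂ W ∧ Module.finrank ℂ W + 1 = r ∧
        ∀ i, (Θ.kummer hpol (x i)).submodule ≤ W)
    (hgen : ∀ j, Projectivization.Independent
      (fun i : {i : Fin r // i ≠ j} => Θ.kummer hpol (x i))) :
    x 0 ∈ Θ.support ∧
    Module.finrank ℂ
      (⨆ i : {i : Fin r // x i ∈ Θ.smoothLocus},
        (Θ.gauss ⟨x i, i.2⟩).submodule : Submodule ℂ (V →L[ℂ] ℂ)) ≤ r / 2 ∧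
    ∀ j, (∀ i, i ≠ j → x i ∈ Θ.singularLocus) → x j ∈ Θ.singularLocus := by
  obtain ⟨H, -, α, -, u, hu, ht⟩ := id hpol
  obtain ⟨c₀, hc₀, hrel₀⟩ := Θ.exists_evalAt_relation hpol x hspan hgen
  obtain ⟨c, hc, hrel⟩ := Θ.exists_theta_relation hu ht hc₀ hrel₀
  have h0 : Θ.eqn (Quotient.out (x 0)) = 0 := by
    have h := hrel 0
    rw [Finset.sum_eq_single 0 (fun i _ hi => by
      simp [(Θ.mem_support_iff_out _).1 (hx i hi)]) (by simp)] at h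
    simpa [hc, hu.2] using h
  have hv : ∀ i, Θ.eqn (Quotient.out (x i)) = 0 := fun i => by
    rcases eq_or_ne i 0 with rfl | hi
    · exact h0
    · exact (Θ.mem_support_iff_out _).1 (hx i hi)
  obtain ⟨c', hc', hquad⟩ := Θ.exists_differential_relation hu hv hc hrel
  refine ⟨(Θ.mem_support_iff_out _).2 h0, ?_, fun j hj => ?_⟩
  · have hle : (⨆ i : {i : Fin r // x i ∈ Θ.smoothLocus}, (Θ.gauss ⟨x i, i.2⟩).submodule) ≤
        Submodule.span ℂ (Set.range fun i => fderiv ℂ Θ.eqn (Quotient.out (x i))) := by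
      refine iSup_le fun i => ?_
      rw [TorusDivisor.gauss, Projectivization.submodule_mk, Submodule.span_singleton_le_iff_mem]
      exact Submodule.subset_span ⟨i, rfl⟩
    have := two_mul_finrank_span_le_card c' hc' _ hquad
    rw [Fintype.card_fin] at this
    have := Submodule.finrank_mono hle
    omega
  · refine (Θ.mem_singularLocus_iff_out _).2 ⟨hv j, ContinuousLinearMap.ext fun a => ?_⟩
    have h := hquad a
    rw [Finset.sum_eq_single j (fun i _ hi => by
      simp [((Θ.mem_singularLocus_iff_out _).1 (hj i hi)).2]) (by simp)] at h
    simpa [hc'] using h
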